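/- \textbf{Theorem (Privacy of NIST-MST).} Let $\mathcal A$ be a finite set of attributes with distinct distinguished attributes SEX, CITY, VALUEH, INCWAGE, each attribute $i$ having a publicly known nonempty finite domain $\Omega_i=\{0,\dots,n_i-1\}\cap\Omega_i^{\mathrm{IPUMS}}$. A dataset is a finite tuple of records in $\prod_i\Omega_i$; $D\sim D'$ if one arises from the other by adding a single record. For a set $C$ of attributes, $M_C(D)$ is the table of counts of the values of $D$ on $C$. Let $\hat D$ be a (public) provisional dataset, $\epsilon>0$, $0<\delta\le 1$, and $$\sigma=\frac{\sqrt{\log(1/\delta)}+\sqrt{\log(1/\delta)+\epsilon}}{\epsilon}.$$ Given a collection $\mathcal C$ of attribute sets with weights $w_C$, the algorithm \emph{Measure} normalizes $w_C\leftarrow w_C/\sqrt{\sum_C w_C^2}$ and outputs, for every $C\in\mathcal C$, the noisy table $\tilde\mu_C=w_CM_C(D)+\mathcal N(0,\sigma^2I)$ (independent noise), together with $w_C,\sigma,C$. The mechanism NIST-MST acts on a sensitive dataset $D$ as follows. 1. \emph{Transform.} In every record, replace VALUEH $=v$ by $\lfloor v/5\rfloor$ if $v\le 25000$, by $5001$ if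 $v=9999998$, by $5002$ if $v=9999999$, and by $5000$ otherwise. Replace INCWAGE $=v$ by two attributes: INCWAGE$_A$ is $\lfloor v/100\rfloor$ if $v\le 5000$, $50$ if $5000<v<9999998$, and $51$ otherwise; INCWAGE$_B$ is the first $k\in\{0,\dots,7\}$ such that $m_k\mid v$, where $(m_0,\dots,m_7)=(100,20,50,25,10,5,2,1)$. The new domains are $\{0,\dots,5002\}$, $\{0,\dots,51\}$, $\{0,\dots,7\}$. 2. \emph{Compress.} Run Measure on the transformed data with all one-way marginals, with weight $2$ for INCWAGE$_A$ and $1$ for the others. For every attribute, values $t$ with $\tilde\mu_t<3\sigma$ are removed from the domain and replaced in the data by a new value $\varnothing$, which is added to the domain. 3. \emph{Select.} Using only the provisional data $\hat D$, transformed and compressed in the same way: let $T$ be a maximum spanning tree of the complete graph on the attributes, with edge weights the empirical mutual information plus $100$ for the three pairs from SEX, CITY, INCWAGE$_A$. For edges $(i,j),(i,k)$ of $T$ let $E_{ijk}=\|M_{ijk}-\tilde M_{ijk}\|_1$, where $\tilde M_{ijk}=M_{ij}M_{ik}/M_i$, and let $F_i$ be a maximum spanning forest of the graph on the $T$-neighbours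 of $i$ whose edges are the pairs $(j,k)$ with $E_{ijk}\ge 0.1$, with weights $E_{ijk}$ (ties are broken arbitrarily). Then $\mathcal C$ consists of the edges of $T$, the three special pairs, the triple SEX, CITY, INCWAGE$_A$, and the sets $\{j,k\},\{i,j,k\}$ for each edge $(j,k)$ of $F_i$, without those whose (compressed) domain has at least $10^6$ elements. The triple SEX, CITY, INCWAGE$_A$ has weight $8$ if $\epsilon\le 0.3$, $4$ if $\epsilon\ge4$, and $6$ otherwise; the special pairs have weight $2$; other sets have weight $1$. 4. \emph{Measure.} Run Measure on the transformed and compressed data with this $\mathcal C$ and these weights. 5. \emph{Synthesize.} From the two lists of measurements alone, Private-PGM computes (measurably) a number of records $N$ and parameters $\theta$ of a graphical model $P_\theta(x)\propto\exp(\sum_C\theta_C(x_C))$, with one factor for each measured $C$, that minimize $\sum_C\|Q_CM_C(NP_\theta)-y_C\|_2^2$ over $\theta$ to some accuracy (which may be arbitrary); here $Q_C = w_CI$, and one-way measurements are re-expressed over the compressed domain. Then $N$ synthetic records are generated by processing the attributes in some order: with $B$ the set of already processed neighbours of $i$ in the graphical model, each group of $g$ rows with equal values $c$ on $B$ gets,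 in column $i$, $\lfloor\mu_t\rfloor$ copies of each $t$, where $\mu_t=g\,P_\theta(x_i=t\mid x_B=c)$, completed to $g$ values by sampling without replacement proportionally to $\mu_t-\lfloor\mu_t\rfloor$, in uniformly random order. 6. \emph{Reverse.} Each $\varnothing$ is replaced by a uniformly random element among the removed values of its attribute (among all values if none was removed). Then VALUEH $=v$ becomes $5v$ if $v\le5000$, $9999998$ if $v=5001$, $9999999$ if $v=5002$; and INCWAGE becomes $100\cdot$INCWAGE$_A+l$ if INCWAGE$_A\le 50$, and $9999998$ if INCWAGE$_A=51$, where $l$ is uniform among the $l\in\{0,\dots,99\}$ whose first divisor in the list $(m_0,\dots,m_7)$ is $m_k$ with $k=$ INCWAGE$_B$. Then NIST-MST is a well-defined randomized mechanism (its output law is a probability measure on the countable set of synthetic datasets), and it is $(\epsilon,\delta)$-differentially private: for all $D\sim D'$ and every set $E$ of possible outputs, $$\Pr[\mathrm{NIST\text{-}MST}(D)\in E]\le e^{\epsilon}\,\Pr[\mathrm{NIST\text{-}MST}(D')\in E]+\delta .$$ -/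

import Mathlib

open MeasureTheory ProbabilityTheory
open scoped NNReal ENNReal

noncomputable section

namespace NISTMST

/-! ### Data, marginals, differential privacy -/

section Data

variable {ι : Type*} (X : ι → Type*)

/-- A record: one value for every attribute. -/
abbrev Rec := (i : ι) → X i

/-- A dataset: a tuple of records of arbitrary finite length. -/
abbrev Dataset := List (Rec X)

/-- The domain `Ω_C` of a set of attributes `C`. -/
abbrev Cell (C : Finset ι) := (i : C) → X i

variable {X}

/-- The marginal `M_C(D)`: the table of counts indexed by `Ω_C`. -/
def marginal [∀ i, DecidableEq (X i)] (C : Finset ι) (D : Dataset X) : Cell X C → ℝ :=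
  fun t => (D.countP (fun x => decide (C.restrict x = t)) : ℝ)

end Data

/-- `D ∼ D'`: one dataset is obtained from the other by adding a single record. -/
def Neighbor {R : Type*} (D D' : List R) : Prop :=
  ∃ (l₁ l₂ : List R) (x : R),
    (D = l₁ ++ l₂ ∧ D' = l₁ ++ x :: l₂) ∨ (D' = l₁ ++ l₂ ∧ D = l₁ ++ x :: l₂)

/-- `(ε, δ)`-differential privacy of a randomized mechanism, given by its output laws. -/
def IsDP {R O : Type*} [MeasurableSpace O] (M : List R → Measure O) (ε δ : ℝ) : Prop :=
  ∀ D D' : List R, Neighbor D D' → ∀ E : Set O, MeasurableSet E →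
    M D E ≤ ENNReal.ofReal (Real.exp ε) * M D' E + ENNReal.ofReal δ

/-! ### Measuring marginals with the Gaussian mechanism -/

section Measure

variable {ι : Type*} [DecidableEq ι] {X : ι → Type*} [∀ i, Fintype (X i)]
  [∀ i, DecidableEq (X i)]

/-- A measurement log for the collection `𝒞`: for each `C ∈ 𝒞` the entry `(w_C, μ̃, σ)`. The fourth
component of the entry, `C` itself, is the index, and the matrix `w_C I` is recorded by `w_C`. -/
abbrev Log (X : ι → Type*) (𝒞 : Finset (Finset ι)) :=
  (C : 𝒞) → ℝ × (Cell X C.1 → ℝ) × ℝ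

/-- Normalization of the weights: `w_C / √(∑_C w_C²)`. -/
def normalizedWeight (𝒞 : Finset (Finset ι)) (w : Finset ι → ℝ) (C : Finset ι) : ℝ :=
  w C / Real.sqrt (∑ B ∈ 𝒞, w B ^ 2)

/-- The algorithm "Measure Marginals": the law of the log obtained by measuring
`w_C M_C(D) + N(0, σ² I)` independently for each `C ∈ 𝒞`, with normalized weights. -/
def measureMarginals (σ : ℝ) (𝒞 : Finset (Finset ι)) (w : Finset ι → ℝ) (D : Dataset X) :
    Measure (Log X 𝒞) :=
  (Measure.pi fun C : 𝒞 => Measure.pi fun _ : Cell X C.1 =>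
      gaussianReal 0 (Real.toNNReal (σ ^ 2))).map
    fun z C => (normalizedWeight 𝒞 w C.1,
      fun t => normalizedWeight 𝒞 w C.1 * marginal C.1 D t + z C t, σ)

/-- The noise scale used by the mechanism. -/
def calibrate (ε δ : ℝ) : ℝ :=
  (Real.sqrt (Real.log (1 / δ)) + Real.sqrt (Real.log (1 / δ) + ε)) / ε

/-- The collection of all one-way marginals. -/
def oneWay (ι : Type*) [Fintype ι] [DecidableEq ι] : Finset (Finset ι) :=
  Finset.univ.image fun i => {i}

lemma singleton_mem_oneWay [Fintype ι] (i : ι) : ({i} : Finset ι) ∈ oneWay ι :=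
  Finset.mem_image_of_mem _ (Finset.mem_univ i)

/-- The element of `Ω_{i}` given by a value of attribute `i`. -/
def singleCell (i : ι) (a : X i) : Cell X {i} :=
  fun j => (Finset.mem_singleton.1 j.2).symm ▸ a

/-- The entry of a log of one-way measurements that belongs to attribute `i`. -/
def oneWayEntry [Fintype ι] (log : Log X (oneWay ι)) (i : ι) :
    ℝ × (Cell X ({i} : Finset ι) → ℝ) × ℝ :=
  log ⟨{i}, singleton_mem_oneWay i⟩

/-- The domain elements of each attribute that survive the threshold test `μ̃_t ≥ 3σ`. -/
def keptValues [Fintype ι] (log : Log X (oneWay ι)) (i : ι) : Finset (X i) :=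
  open Classical in
  Finset.univ.filter fun a =>
    3 * (oneWayEntry log i).2.2 ≤ (oneWayEntry log i).2.1 (singleCell i a)

/-- Domain compression of a record: values that were not kept are replaced by `∅`,
represented by `none`. -/
def compressRecord (K : (i : ι) → Finset (X i)) (x : Rec X) :
    Rec fun i => Option {a // a ∈ K i} :=
  fun i => if h : x i ∈ K i then some ⟨x i, h⟩ else none

end Measure

/-! ### Encoding and transforming the domain -/

/-- Public information about the table: the attributes `A`, with four distinguished ones, the size
`n_i` from the specification file, the set of possible values from the documentation. -/
structure Schema (A : Type*) where
  specs : A → ℕ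
  ipums : A → Finset ℕ
  sex : A
  city : A
  valueh : A
  incwage : A
  distinct : [sex, city, valueh, incwage].Nodup
  nonempty : ∀ i, (Finset.range (specs i) ∩ ipums i).Nonempty

section Transform

variable {A : Type*} [DecidableEq A]

/-- The encoded domain of attribute `i`: the intersection of `{0, …, n_i - 1}` with the documented
values. -/
def Schema.dom (S : Schema A) (i : A) : Finset ℕ := Finset.range (S.specs i) ∩ S.ipums i

/-- The original domain, as a family of types. -/
abbrev Val (S : Schema A) (i : A) := {v : ℕ // v ∈ S.dom i}

/-- Attributes after the transformation step: `some INCWAGE` stands for `INCWAGE_A`, `none` for the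
additional attribute `INCWAGE_B`, and `some i` for any other attribute `i`. -/
abbrev TAttr (A : Type*) := Option A

/-- The transformed domain. -/
def Schema.tdom (S : Schema A) : TAttr A → Finset ℕ
  | none => Finset.range 8
  | some i =>
    if i = S.valueh then Finset.range 5003
    else if i = S.incwage then Finset.range 52
    else S.dom i

/-- The transformed domain, as a family of types. -/
abbrev TVal (S : Schema A) (i : TAttr A) := {v : ℕ // v ∈ S.tdom i}

lemma Schema.tdom_nonempty (S : Schema A) (i : TAttr A) : (S.tdom i).Nonempty := by
  rcases i with _ | i
  · exact ⟨0, by simp [Schema.tdom]⟩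
  · unfold Schema.tdom
    dsimp only
    split_ifs
    · exact ⟨0, by simp⟩
    · exact ⟨0, by simp⟩
    · exact S.nonempty i

def transformValueh (v : ℕ) : ℕ :=
  if v ≤ 25000 then v / 5
  else if v = 9999998 then 5001
  else if v = 9999999 then 5002
  else 5000

/-- On the values `0, …, 9999998` of `INCWAGE` the last case is `INCWAGE = 9999998`. -/
def transformIncwageA (v : ℕ) : ℕ :=
  if v ≤ 5000 then v / 100
  else if v < 9999998 then 50
  else 51

def transformIncwageB (v : ℕ) : ℕ :=
  if v % 100 = 0 then 0
  else if v % 20 = 0 then 1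
  else if v % 50 = 0 then 2
  else if v % 25 = 0 then 3
  else if v % 10 = 0 then 4
  else if v % 5 = 0 then 5
  else if v % 2 = 0 then 6
  else 7

/-- The values of a transformed record. -/
def transformRaw (S : Schema A) (x : Rec (Val S)) : TAttr A → ℕ
  | none => transformIncwageB (x S.incwage)
  | some i =>
    if i = S.valueh then transformValueh (x i)
    else if i = S.incwage then transformIncwageA (x i)
    else x i

lemma transformRaw_mem (S : Schema A) (x : Rec (Val S)) (i : TAttr A) :
    transformRaw S x i ∈ S.tdom i := by
  rcases i with _ | i
  · simp only [transformRaw, Schema.tdom, transformIncwageB, Finset.mem_range]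
    split_ifs <;> omega
  · simp only [transformRaw, Schema.tdom]
    split_ifs
    · simp only [transformValueh, Finset.mem_range]
      split_ifs <;> omega
    · simp only [transformIncwageA, Finset.mem_range]
      split_ifs <;> omega
    · exact (x i).2

/-- The algorithm "Transform data", on one record. -/
def transformRecord (S : Schema A) (x : Rec (Val S)) : Rec (TVal S) :=
  fun i => ⟨transformRaw S x i, transformRaw_mem S x i⟩

/-- The possible outcomes of the threshold test: a set of surviving values for each attribute. -/
abbrev Kept (S : Schema A) := (i : TAttr A) → Finset (TVal S i)

/-- The compressed domain: the surviving values together with `∅`, represented by `none`. -/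
abbrev CVal (S : Schema A) (K : Kept S) (i : TAttr A) := Option {a : TVal S i // a ∈ K i}

/-- Weights of the one-way marginals. -/
def oneWayWeight (S : Schema A) (C : Finset (TAttr A)) : ℝ :=
  if C = {some S.incwage} then 2 else 1

end Transform

/-! ### Selecting marginals from the public provisional data -/

section Select

variable {ι : Type*} {X : ι → Type*} [∀ i, Fintype (X i)] [∀ i, DecidableEq (X i)]

/-- Empirical mutual information between two attributes. -/
def mutualInformation (D : Dataset X) (i j : ι) : ℝ :=
  ∑ a : X i, ∑ b : X j,
    let pij : ℝ := (D.countP fun x => decide (x i = a ∧ x j = b)) / D.length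
    let pi : ℝ := (D.countP fun x => decide (x i = a)) / D.length
    let pj : ℝ := (D.countP fun x => decide (x j = b)) / D.length
    pij * Real.log (pij / (pi * pj))

/-- `‖M_ijk - M̃_ijk‖₁`, where `M̃_ijk` is the estimate obtained from the exact marginals `M_ij` and
`M_ik`, i.e. the maximum entropy table with these marginals:
`M̃_ijk(a, b, c) = M_ij(a, b) M_ik(a, c) / M_i(a)`. -/
def tripleError (D : Dataset X) (i j k : ι) : ℝ :=
  ∑ a : X i, ∑ b : X j, ∑ c : X k,
    |((D.countP fun x => decide (x i = a ∧ x j = b ∧ x k = c) : ℕ) : ℝ) -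
      ((D.countP fun x => decide (x i = a ∧ x j = b) : ℕ) : ℝ) *
        ((D.countP fun x => decide (x i = a ∧ x k = c) : ℕ) : ℝ) /
        ((D.countP fun x => decide (x i = a) : ℕ) : ℝ)|

open Classical in
/-- Total weight of a graph, for a symmetric weight function (each edge is counted twice). -/
def graphWeight [Fintype ι] (wt : ι → ι → ℝ) (T : SimpleGraph ι) : ℝ :=
  ∑ u, ∑ v, if T.Adj u v then wt u v else 0

/-- `T` is a spanning forest of `G`: acyclic, with the same connected components. It is a spanning
tree if `G` is connected. -/
def IsSpanningForest (G T : SimpleGraph ι) : Prop :=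
  T ≤ G ∧ T.IsAcyclic ∧ ∀ u v, G.Reachable u v → T.Reachable u v

/-- `T` is a spanning forest of `G` of maximum total weight. -/
def IsMaxSpanningForest [Fintype ι] (wt : ι → ι → ℝ) (G T : SimpleGraph ι) : Prop :=
  IsSpanningForest G T ∧ ∀ T', IsSpanningForest G T' → graphWeight wt T' ≤ graphWeight wt T

variable [DecidableEq ι]

/-- The three special pairs. -/
def specialPairs (sex city inc : ι) : Finset (Finset ι) := {{sex, city}, {sex, inc}, {city, inc}}

/-- Edge weights of the correlation graph. -/
def correlationWeight (D : Dataset X) (sex city inc : ι) (i j : ι) : ℝ :=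
  mutualInformation D i j + if {i, j} ∈ specialPairs sex city inc then 100 else 0

/-- The graph on the neighbours of `i` in `T` that keeps the edges of weight at least `0.1`. The
other attributes are isolated. -/
def neighborGraph (D : Dataset X) (T : SimpleGraph ι) (i : ι) : SimpleGraph ι :=
  SimpleGraph.fromRel fun j k => T.Adj i j ∧ T.Adj i k ∧ 0.1 ≤ tripleError D i j k

/-- `𝒞` is a possible outcome of the marginal selection algorithm on the provisional data `D`.
Maximum spanning trees may be chosen arbitrarily in case of ties. -/
def IsSelected [Fintype ι] (D : Dataset X) (sex city inc : ι) (𝒞 : Finset (Finset ι)) : Prop :=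
  ∃ (T : SimpleGraph ι) (F : ι → SimpleGraph ι),
    IsMaxSpanningForest (correlationWeight D sex city inc) ⊤ T ∧
    (∀ i, IsMaxSpanningForest (tripleError D i) (neighborGraph D T i) (F i)) ∧
    ∀ C : Finset ι, C ∈ 𝒞 ↔
      ((∃ i j, T.Adj i j ∧ C = {i, j}) ∨
        C ∈ specialPairs sex city inc ∨
        C = {sex, city, inc} ∨
        (∃ i j k, (F i).Adj j k ∧ (C = {j, k} ∨ C = {i, j, k}))) ∧
      ∏ i ∈ C, Fintype.card (X i) < 10 ^ 6

/-- The (unnormalized) weights assigned to the selected marginals. -/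
def selectionWeight (ε : ℝ) (sex city inc : ι) (C : Finset ι) : ℝ :=
  if C = {sex, city, inc} then
    if ε ≤ 0.3 then 8 else if 4 ≤ ε then 4 else 6
  else if C ∈ specialPairs sex city inc then 2
  else 1

end Select

/-! ### Private-PGM: estimating a graphical model -/

section PGM

variable {ι : Type*} [Fintype ι] [DecidableEq ι] {Z : ι → Type*} [∀ i, Fintype (Z i)]
  [∀ i, DecidableEq (Z i)]

/-- The parameter `θ` of a graphical model with one factor for each `C ∈ 𝒞`. -/
abbrev Potential (Z : ι → Type*) (𝒞 : Finset (Finset ι)) := (C : 𝒞) → Cell Z C.1 → ℝ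

/-- The distribution `P_θ(x) ∝ exp (∑_C θ_C(x_C))`. -/
def modelProb {𝒞 : Finset (Finset ι)} (θ : Potential Z 𝒞) (x : Rec Z) : ℝ :=
  Real.exp (∑ C : 𝒞, θ C (C.1.restrict x)) /
    ∑ y : Rec Z, Real.exp (∑ C : 𝒞, θ C (C.1.restrict y))

/-- The marginal on `C` of the model, scaled to `N` records. -/
def modelMarginal {𝒞 : Finset (Finset ι)} (N : ℕ) (θ : Potential Z 𝒞) (C : Finset ι)
    (t : Cell Z C) : ℝ :=
  N * ∑ x : Rec Z, if C.restrict x = t then modelProb θ x else 0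

end PGM

section Solver

variable {A : Type*} [Fintype A] [DecidableEq A] (S : Schema A)

/-- The Private-PGM objective `∑ ‖Q M(P_θ) - y‖²`. The first sum is over the measurements made on
the compressed domain. The second is over the one-way measurements, re-expressed over the compressed
domain: the measurements of the `r` removed values of attribute `i` are added up to a measurement of
`∅` and divided by `√r` (so that its noise has scale `σ` again). -/
def pgmLoss (K : Kept S) {𝒞 𝒞' : Finset (Finset (TAttr A))}
    (log₁ : Log (TVal S) (oneWay (TAttr A))) (log₂ : Log (CVal S K) 𝒞)
    (N : ℕ) (θ : Potential (CVal S K) 𝒞') : ℝ :=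
  (∑ C : 𝒞, ∑ t, ((log₂ C).1 * modelMarginal N θ C.1 t - (log₂ C).2.1 t) ^ 2) +
  ∑ i : TAttr A,
    ((∑ a : {a // a ∈ K i},
        ((oneWayEntry log₁ i).1 * modelMarginal N θ {i} (singleCell i (some a)) -
          (oneWayEntry log₁ i).2.1 (singleCell i a.1)) ^ 2) +
      ((oneWayEntry log₁ i).1 * modelMarginal N θ {i} (singleCell i none) -
        ∑ a ∈ (K i)ᶜ, (oneWayEntry log₁ i).2.1 (singleCell i a)) ^ 2 / ((K i)ᶜ.card : ℝ))

/-- A Private-PGM solver: it computes from the two logs an estimate of the number of records and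
parameters `θ` of a graphical model, with one factor for each measured marginal, which minimize the
objective up to `tol`. The accuracy `tol` is arbitrary (`0` for an exact solver, `∞` for one without
any guarantee). -/
structure PrivatePGM (sel : Kept S → Finset (Finset (TAttr A))) where
  total : (K : Kept S) → Log (TVal S) (oneWay (TAttr A)) → Log (CVal S K) (sel K) → ℕ
  potential : (K : Kept S) → Log (TVal S) (oneWay (TAttr A)) → Log (CVal S K) (sel K) →
    Potential (CVal S K) (oneWay (TAttr A) ∪ sel K)
  measurable_total : ∀ K, Measurable
    fun p : Log (TVal S) (oneWay (TAttr A)) × Log (CVal S K) (sel K) => total K p.1 p.2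
  measurable_potential : ∀ K, Measurable
    fun p : Log (TVal S) (oneWay (TAttr A)) × Log (CVal S K) (sel K) => potential K p.1 p.2
  tol : ℝ≥0∞
  optimal : ∀ K log₁ log₂ (θ : Potential (CVal S K) (oneWay (TAttr A) ∪ sel K)),
    ENNReal.ofReal (pgmLoss S K log₁ log₂ (total K log₁ log₂) (potential K log₁ log₂)) ≤
      ENNReal.ofReal (pgmLoss S K log₁ log₂ (total K log₁ log₂) θ) + tol

end Solver

/-! ### Private-PGM: generating synthetic records -/

section Generate

/-- Sample `k` items without replacement, each draw being proportional to the weights `p` of the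
remaining items (stop if no item of positive weight remains). -/
def sampleWithoutReplacement {T : Type*} [Fintype T] [DecidableEq T] :
    ℕ → (T → ℝ≥0) → PMF (Finset T)
  | 0, _ => PMF.pure ∅
  | k + 1, p =>
    open Classical in
    if h : ∑' t, (p t : ℝ≥0∞) ≠ 0 then
      (PMF.normalize (fun t => (p t : ℝ≥0∞)) h
          (by rw [tsum_fintype]; exact ENNReal.sum_ne_top.2 fun _ _ => ENNReal.coe_ne_top)).bind
        fun t => (sampleWithoutReplacement k (Function.update p t 0)).map (insert t)
    else PMF.pure ∅

/-- Uniformly random rearrangement of a list. -/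
def shuffle {T : Type*} (l : List T) : PMF (List T) :=
  (PMF.uniformOfFintype (Equiv.Perm (Fin l.length))).map fun e => List.ofFn fun k => l.get (e k)

/-- The algorithm "Synthetic column", for a vector `μ` of fractional counts and `n` records. -/
def syntheticColumn {T : Type*} [Fintype T] [DecidableEq T] (μ : T → ℝ) (n : ℕ) : PMF (List T) :=
  (sampleWithoutReplacement (n - ∑ t, ⌊μ t⌋₊) fun t => Real.toNNReal (μ t - ⌊μ t⌋₊)).bind
    fun extra => shuffle ((∑ t, Multiset.replicate ⌊μ t⌋₊ t) + extra.val).toList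

variable {ι : Type*} [Fintype ι] [DecidableEq ι] {Z : ι → Type*} [∀ i, Fintype (Z i)]
  [∀ i, DecidableEq (Z i)]

/-- Neighbours of an attribute in the graphical model with factors `𝒞`. -/
def modelNeighbors (𝒞 : Finset (Finset ι)) (i : ι) : Finset ι :=
  Finset.univ.filter fun j => j ≠ i ∧ ∃ C ∈ 𝒞, i ∈ C ∧ j ∈ C

/-- `P(x_i = t | x_B = c)`. -/
def conditionalProb (P : Rec Z → ℝ) (i : ι) (B : Finset ι) (c : Cell Z B) (t : Z i) : ℝ :=
  (∑ x : Rec Z, if B.restrict x = c ∧ x i = t then P x else 0) /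
    ∑ x : Rec Z, if B.restrict x = c then P x else 0

/-- Fill column `i`, group by group. The groups are the sets of rows with equal values on `B`; the
fractional counts for a group of `g` rows are `g · P(x_i = t | x_B = c)`. -/
def fillColumn (P : Rec Z → ℝ) (i : ι) (B : Finset ι) {n : ℕ} :
    List (Cell Z B) → (Fin n → Rec Z) → PMF (Fin n → Rec Z)
  | [], r => PMF.pure r
  | c :: cs, r =>
    let G : Finset (Fin n) := Finset.univ.filter fun k => B.restrict (r k) = c
    (syntheticColumn (fun t => G.card * conditionalProb P i B c t) G.card).bind fun col =>
      fillColumn P i B cs fun k =>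
        if k ∈ G then
          Function.update (r k) i (col.getD (G.filter fun k' => k' < k).card (r k i))
        else r k

/-- The main loop of the algorithm "Synthetic data generation": process the attributes in the given
list, starting from the set `done` of processed attributes and the rows `r`. -/
def fillColumns (P : Rec Z → ℝ) (𝒞 : Finset (Finset ι)) {n : ℕ} :
    List ι → Finset ι → (Fin n → Rec Z) → PMF (Fin n → Rec Z)
  | [], _, r => PMF.pure r
  | i :: is, done, r =>
    (fillColumn P i (modelNeighbors 𝒞 i ∩ done) Finset.univ.toList r).bind
      fun r' => fillColumns P 𝒞 is (insert i done) r'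

/-- The algorithm "Synthetic data generation" for the model `P_θ` and `n` records, processing the
attributes in the given order. The columns of `init` are placeholders: each column is overwritten
before it is read. -/
def generate {𝒞 : Finset (Finset ι)} (θ : Potential Z 𝒞) (n : ℕ) (order : List ι) (init : Rec Z) :
    PMF (Dataset Z) :=
  (fillColumns (modelProb θ) 𝒞 order ∅ fun _ : Fin n => init).map fun r => List.ofFn r

end Generate

/-! ### Reversing the compression and the transformation -/

section Reverse

variable {A : Type*} [DecidableEq A] (S : Schema A)

/-- The original values that a compressed value may stand for: `∅` stands for the removed values
(for all values if none were removed). -/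
def candidates (K : Kept S) (i : TAttr A) : CVal S K i → Finset (TVal S i)
  | some a => {a.1}
  | none => if (K i)ᶜ = ∅ then Finset.univ else (K i)ᶜ

lemma candidates_nonempty (K : Kept S) (i : TAttr A) (z : CVal S K i) :
    (candidates S K i z).Nonempty := by
  rcases z with _ | a
  · unfold candidates
    dsimp only
    split_ifs with h
    · obtain ⟨v, hv⟩ := S.tdom_nonempty i
      exact ⟨⟨v, hv⟩, Finset.mem_univ _⟩
    · exact Finset.nonempty_iff_ne_empty.2 h
  · exact ⟨a.1, Finset.mem_singleton_self _⟩

/-- Reverse the domain compression on one record: each `∅` is independently replaced by a uniformly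
distributed candidate. -/
def decompressRecord [Fintype A] (K : Kept S) (z : Rec (CVal S K)) : PMF (Rec (TVal S)) :=
  PMF.uniformOfFinset (Fintype.piFinset fun i => candidates S K i (z i))
    (Fintype.piFinset_nonempty.2 fun i => candidates_nonempty S K i (z i))

/-- The moduli used to generate the last two digits. -/
def digitModuli : Fin 8 → ℕ := ![100, 20, 50, 25, 10, 5, 2, 1]

/-- The set `L_k` of two-digit endings that are divisible by the modulus `m_k` and by none of the
previous ones. -/
def digitSet (k : Fin 8) : Finset ℕ :=
  (Finset.range 100).filter fun l =>
    l % digitModuli k = 0 ∧ ∀ j : Fin 8, j < k → l % digitModuli j ≠ 0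

lemma digitSet_nonempty (k : Fin 8) : (digitSet k).Nonempty := by
  fin_cases k
  · exact ⟨0, by decide⟩
  · exact ⟨20, by decide⟩
  · exact ⟨50, by decide⟩
  · exact ⟨25, by decide⟩
  · exact ⟨10, by decide⟩
  · exact ⟨5, by decide⟩
  · exact ⟨2, by decide⟩
  · exact ⟨1, by decide⟩

/-- Convert a value of `INCWAGE_B` to `DIGITS`. -/
def sampleDigits (k : Fin 8) : PMF ℕ := PMF.uniformOfFinset (digitSet k) (digitSet_nonempty k)

def reverseValueh (v : ℕ) : ℕ :=
  if v ≤ 5000 then 5 * v else if v = 5001 then 9999998 else 9999999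

def reverseIncwage (v digits : ℕ) : ℕ :=
  if v ≤ 50 then 100 * v + digits else 9999998

/-- Reverse the transformation step on one record. -/
def reverseRecord (x : Rec (TVal S)) : PMF (A → ℕ) :=
  (sampleDigits ⟨(x none).1, Finset.mem_range.1 (x none).2⟩).map fun digits i =>
    if i = S.valueh then reverseValueh (x (some i))
    else if i = S.incwage then reverseIncwage (x (some i)) digits
    else x (some i)

/-- Apply a randomized map independently to all entries of a list. -/
def sampleEach {α β : Type*} (f : α → PMF β) : List α → PMF (List β)
  | [] => PMF.pure []
  | a :: l => (f a).bind fun b => (sampleEach f l).map fun l' => b :: l'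

end Reverse

/-! ### The mechanism -/

/-- The output space: synthetic tables with the original attributes, with all sets measurable. -/
def SynthData (A : Type*) := List (A → ℕ)

instance (A : Type*) : MeasurableSpace (SynthData A) := ⊤

section Mechanism

variable {A : Type*} [Fintype A] [DecidableEq A] (S : Schema A)

/-- The provisional data, transformed and compressed. -/
def compressedData (K : Kept S) (D : Dataset (Val S)) : Dataset (CVal S K) :=
  (D.map (transformRecord S)).map (compressRecord K)

/-- Possible outcomes of the selection step on the (transformed and compressed) provisional data,
for all possible outcomes `K` of the compression step. -/
def IsSelection (provisional : Dataset (Val S)) (sel : Kept S → Finset (Finset (TAttr A))) : Prop :=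
  ∀ K : Kept S, IsSelected (compressedData S K provisional)
    (some S.sex) (some S.city) (some S.incwage) (sel K)

/-- Synthesize data from the two logs, and reverse the compression and the transformation. -/
def synthesize {sel : Kept S → Finset (Finset (TAttr A))} (pgm : PrivatePGM S sel)
    (order : Kept S → List (TAttr A)) (K : Kept S)
    (log₁ : Log (TVal S) (oneWay (TAttr A))) (log₂ : Log (CVal S K) (sel K)) : PMF (SynthData A) :=
  (generate (pgm.potential K log₁ log₂) (pgm.total K log₁ log₂) (order K) fun _ => none).bind
    (sampleEach fun z => (decompressRecord S K z).bind (reverseRecord S))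

/-- The output law of NIST-MST on the sensitive data `D`. -/
def nistMST {sel : Kept S → Finset (Finset (TAttr A))} (pgm : PrivatePGM S sel)
    (order : Kept S → List (TAttr A)) (ε δ : ℝ) (D : Dataset (Val S)) : Measure (SynthData A) :=
  let σ := calibrate ε δ
  (measureMarginals σ (oneWay (TAttr A)) (oneWayWeight S) (D.map (transformRecord S))).bind
    fun log₁ =>
      let K : Kept S := keptValues log₁
      (measureMarginals σ (sel K)
          (selectionWeight ε (some S.sex) (some S.city) (some S.incwage))
          (compressedData S K D)).bind
        fun log₂ => (synthesize S pgm order K log₁ log₂).toMeasure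

end Mechanism

end NISTMST

end

/-! The sensitive data enters only through two calls of Measure; everything else is post-processing
of the two logs or uses public data. Adding a record changes one cell of each marginal table by one,
so the weighted tables move by a squared Euclidean distance `∑ w_C²`, at most 1 after normalization.
Hence in each call the density `p` between the two output laws satisfies `∫ p^(1+s) ≤ exp
(s(1+s)/(2σ²))`: this is the Gaussian computation `renyiBound_gaussianReal`, made additive over
cells by `RenyiBound.pi` and assembled in `renyiBound_measureMarginals`.

The second call depends on the first only through the surviving values `K`, and its bound is uniform
in `K`, so the exponents add. A Chernoff bound on the privacy loss
(`RenyiBound.lintegral_lintegral_le`) then gives `e^ε Pr' + exp (-εs + s(1+s)/σ²)`. With `s = √(log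
(1/δ)) σ` the calibrated `σ` makes the last term equal to `δ` (`exp_calibrate`).

Post-processing enters as a randomized test: the probability of the event given both logs, a number
in `[0, 1]`. This requires the synthesis step to be a measurable kernel. Its discrete data
(surviving values, floors, number of records) take countably many values, and on each fibre the
probabilities are measurable functions of the logs. -/

namespace NISTMST

/-! ### Rényi moment bounds: Gaussians, products, adaptive composition. -/

section Renyi

/-- `μ` has a density with respect to `ν` whose moment of order `1 + s` is at most `exp c`. For
`s > 0` this says that the Rényi divergence of order `1 + s` is at most `c / s`. -/
def RenyiBound {α : Type*} [MeasurableSpace α] (s c : ℝ) (μ ν : Measure α) : Prop :=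
  ∃ p : α → ℝ≥0∞, Measurable p ∧ μ = ν.withDensity p ∧
    ∫⁻ x, p x ^ (1 + s) ∂ν ≤ ENNReal.ofReal (Real.exp c)

lemma RenyiBound.mono {α : Type*} [MeasurableSpace α] {s c c' : ℝ} {μ ν : Measure α}
    (h : RenyiBound s c μ ν) (hc : c ≤ c') : RenyiBound s c' μ ν := by
  obtain ⟨p, hp, hμ, hb⟩ := h
  exact ⟨p, hp, hμ, hb.trans (ENNReal.ofReal_le_ofReal (Real.exp_le_exp.2 hc))⟩

/-- Rényi bounds are preserved by injective maps with a measurable left inverse. -/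
lemma RenyiBound.map {α β : Type*} [MeasurableSpace α] [MeasurableSpace β] {s c : ℝ}
    {μ ν : Measure α} (h : RenyiBound s c μ ν) {g : α → β} {l : β → α} (hg : Measurable g)
    (hl : Measurable l) (hlg : ∀ x, l (g x) = x) : RenyiBound s c (μ.map g) (ν.map g) := by
  obtain ⟨p, hp, rfl, hb⟩ := h
  refine ⟨p ∘ l, hp.comp hl, ?_, ?_⟩
  · ext t ht
    rw [Measure.map_apply hg ht, withDensity_apply _ (hg ht), withDensity_apply _ ht,
      setLIntegral_map ht (hp.comp hl) hg]
    simp [hlg]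
  · rw [lintegral_map ((hp.comp hl).pow_const _) hg]
    simpa [hlg] using hb

/-- Two Gaussian measures with the same variance. -/
lemma renyiBound_gaussianReal (s m m' : ℝ) {v : ℝ≥0} (hv : v ≠ 0) :
    RenyiBound s (s * (1 + s) / 2 * (m - m') ^ 2 / v) (gaussianReal m v) (gaussianReal m' v) := by
  have hv' : (v : ℝ) ≠ 0 := by exact_mod_cast hv
  have hmeas : Measurable fun x : ℝ =>
      ENNReal.ofReal (Real.exp (((x - m') ^ 2 - (x - m) ^ 2) / (2 * v))) := by fun_prop
  refine ⟨_, hmeas, ?_, ?_⟩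
  · rw [gaussianReal_of_var_ne_zero _ hv, gaussianReal_of_var_ne_zero _ hv,
      ← withDensity_mul _ (measurable_gaussianPDF _ _) hmeas]
    congr 1
    ext x
    simp only [Pi.mul_apply, gaussianPDF, gaussianPDFReal]
    rw [← ENNReal.ofReal_mul (by positivity), mul_assoc _ (Real.exp _), ← Real.exp_add]
    congr 3
    field_simp
    ring
  · rw [gaussianReal_of_var_ne_zero _ hv,
      lintegral_withDensity_eq_lintegral_mul _ (measurable_gaussianPDF _ _) (hmeas.pow_const _)]
    -- Completing the square: the integrand is a constant times the Gaussian density with mean moved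
    -- to `m' + (1 + s)(m - m')`, and that density integrates to one.
    have key : ∀ x : ℝ, (gaussianPDF m' v * fun x : ℝ =>
        ENNReal.ofReal (Real.exp (((x - m') ^ 2 - (x - m) ^ 2) / (2 * v))) ^ (1 + s)) x =
        ENNReal.ofReal (Real.exp (s * (1 + s) / 2 * (m - m') ^ 2 / v)) *
          gaussianPDF (m' + (1 + s) * (m - m')) v x := by
      intro x
      simp only [Pi.mul_apply, gaussianPDF, gaussianPDFReal]
      rw [ENNReal.ofReal_rpow_of_pos (Real.exp_pos _), ← Real.exp_mul,
        ← ENNReal.ofReal_mul (by positivity), ← ENNReal.ofReal_mul (by positivity), mul_assoc,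
        mul_left_comm (Real.exp _), ← Real.exp_add, ← Real.exp_add]
      congr 3
      field_simp
      ring
    simp_rw [key]
    rw [lintegral_const_mul _ (measurable_gaussianPDF _ _), lintegral_gaussianPDF_eq_one _ hv,
      mul_one]

lemma lintegral_pi_prod {ι : Type*} [Fintype ι] {X : ι → Type*} [∀ i, MeasurableSpace (X i)]
    (ν : (i : ι) → Measure (X i)) [∀ i, IsProbabilityMeasure (ν i)] (f : (i : ι) → X i → ℝ≥0∞)
    (hf : ∀ i, Measurable (f i)) :
    ∫⁻ x, ∏ i, f i (x i) ∂(Measure.pi ν) = ∏ i, ∫⁻ x, f i x ∂(ν i) := by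
  have hind : iIndepFun (fun i (x : (i : ι) → X i) => f i (x i)) (Measure.pi ν) :=
    iIndepFun_pi fun i => (hf i).aemeasurable
  rw [lintegral_prod_eq_prod_lintegral_of_indepFun Finset.univ _ hind
    fun i => (hf i).comp (measurable_pi_apply i)]
  refine Finset.prod_congr rfl fun i _ => ?_
  rw [← (measurePreserving_eval ν i).map_eq, lintegral_map (hf i) (measurable_pi_apply i)]

lemma pi_withDensity {ι : Type*} [Fintype ι] {X : ι → Type*} [∀ i, MeasurableSpace (X i)]
    (ν : (i : ι) → Measure (X i)) [∀ i, IsProbabilityMeasure (ν i)] (p : (i : ι) → X i → ℝ≥0∞)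
    (hp : ∀ i, Measurable (p i)) [∀ i, SigmaFinite ((ν i).withDensity (p i))] :
    Measure.pi (fun i => (ν i).withDensity (p i)) =
      (Measure.pi ν).withDensity fun x => ∏ i, p i (x i) := by
  classical
  refine Measure.pi_eq fun t ht => ?_
  rw [withDensity_apply _ (MeasurableSet.univ_pi ht), ← lintegral_indicator (MeasurableSet.univ_pi ht)]
  -- The indicator of a box is the product of the indicators of its sides, so the integral over a
  -- box factorizes.
  have : ∀ x : (i : ι) → X i, (Set.univ.pi t).indicator (fun x => ∏ i, p i (x i)) x =
      ∏ i, (t i).indicator (p i) (x i) := by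
    intro x
    by_cases hx : x ∈ Set.univ.pi t
    · rw [Set.indicator_of_mem hx]
      exact Finset.prod_congr rfl fun i _ => (Set.indicator_of_mem (hx i trivial) _).symm
    · rw [Set.indicator_of_notMem hx]
      obtain ⟨i, hi⟩ : ∃ i, x i ∉ t i := by simpa [Set.mem_pi] using hx
      exact (Finset.prod_eq_zero (Finset.mem_univ i) (Set.indicator_of_notMem hi _)).symm
  simp_rw [this]
  rw [lintegral_pi_prod ν _ fun i => (hp i).indicator (ht i)]
  refine Finset.prod_congr rfl fun i _ => ?_
  rw [lintegral_indicator (ht i), withDensity_apply _ (ht i)]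

/-- Rényi bounds add up over independent components. -/
lemma RenyiBound.pi {ι : Type*} [Fintype ι] {X : ι → Type*} [∀ i, MeasurableSpace (X i)]
    {μ ν : (i : ι) → Measure (X i)} [∀ i, IsProbabilityMeasure (μ i)]
    [∀ i, IsProbabilityMeasure (ν i)] {s : ℝ} (hs : 0 ≤ s) {c : ι → ℝ}
    (h : ∀ i, RenyiBound s (c i) (μ i) (ν i)) :
    RenyiBound s (∑ i, c i) (Measure.pi μ) (Measure.pi ν) := by
  choose p hp hμ hb using h
  have : ∀ i, SigmaFinite ((ν i).withDensity (p i)) := fun i => hμ i ▸ inferInstance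
  refine ⟨fun x => ∏ i, p i (x i), by fun_prop, ?_, ?_⟩
  · rw [← pi_withDensity ν p hp]
    congr 1
    exact funext hμ
  · simp_rw [← ENNReal.prod_rpow_of_nonneg (show 0 ≤ 1 + s by linarith)]
    rw [lintegral_pi_prod ν (fun i x => p i x ^ (1 + s)) fun i => (hp i).pow_const _, Real.exp_sum,
      ENNReal.ofReal_prod_of_nonneg fun i _ => (Real.exp_pos _).le]
    exact Finset.prod_le_prod' fun i _ => hb i

/-- Chernoff bound for the privacy loss, pointwise. -/
lemma mul_le_exp_mul_add {f p : ℝ≥0∞} (hf : f ≤ 1) {s : ℝ} (hs : 0 ≤ s) (ε : ℝ) :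
    p * f ≤ ENNReal.ofReal (Real.exp ε) * f +
      ENNReal.ofReal (Real.exp (-(ε * s))) * p ^ (1 + s) := by
  rcases le_total p (ENNReal.ofReal (Real.exp ε)) with h | h
  -- While the density is at most `e^ε` the first term suffices. Beyond that, `1 ≤ (p / e^ε)^s`, so
  -- `p f ≤ p` is absorbed by the second.
  · exact (mul_le_mul_left h f).trans le_self_add
  · refine le_add_left ((mul_le_of_le_one_right' hf).trans ?_)
    rw [ENNReal.rpow_add_of_nonneg _ _ zero_le_one hs, ENNReal.rpow_one, mul_left_comm]
    refine le_mul_of_one_le_right' ?_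
    calc (1 : ℝ≥0∞)
        = ENNReal.ofReal (Real.exp (-(ε * s))) * ENNReal.ofReal (Real.exp ε) ^ s := by
          rw [ENNReal.ofReal_rpow_of_pos (Real.exp_pos _), ← Real.exp_mul,
            ← ENNReal.ofReal_mul (Real.exp_pos _).le, ← Real.exp_add]
          simp
      _ ≤ _ := by gcongr

/-- Adaptive composition of two mechanisms, followed by the randomized test `f`. -/
lemma RenyiBound.lintegral_lintegral_le {α : Type*} {β : α → Type*} [MeasurableSpace α]
    [∀ a, MeasurableSpace (β a)] {s c₁ c₂ : ℝ} (hs : 0 ≤ s) {μ₁ ν₁ : Measure α}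
    {μ₂ ν₂ : (a : α) → Measure (β a)} (h₁ : RenyiBound s c₁ μ₁ ν₁)
    (h₂ : ∀ a, RenyiBound s c₂ (μ₂ a) (ν₂ a)) {f : (a : α) → β a → ℝ≥0∞}
    (hf : ∀ a b, f a b ≤ 1) (hfm : ∀ a, Measurable (f a))
    (hμ : Measurable fun a => ∫⁻ b, f a b ∂(μ₂ a)) (ε : ℝ) :
    ∫⁻ a, ∫⁻ b, f a b ∂(μ₂ a) ∂μ₁ ≤
      ENNReal.ofReal (Real.exp ε) * ∫⁻ a, ∫⁻ b, f a b ∂(ν₂ a) ∂ν₁ +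
        ENNReal.ofReal (Real.exp (-(ε * s) + (c₁ + c₂))) := by
  obtain ⟨p, hp, rfl, hpb⟩ := h₁
  choose q hq hμ₂ hqb using h₂
  have hs' : 0 ≤ 1 + s := by linarith
  set e := ENNReal.ofReal (Real.exp ε)
  set d := ENNReal.ofReal (Real.exp (-(ε * s)))
  set b₂ := ENNReal.ofReal (Real.exp c₂)
  -- The pointwise bound is applied to the product density `p a * q a b`. Integrating over `b`
  -- first, with `a` fixed, avoids any need for joint measurability of `q`, which is chosen
  -- separately for each `a`.
  have inner : ∀ a, p a * ∫⁻ b, f a b ∂(μ₂ a) ≤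
      e * (∫⁻ b, f a b ∂(ν₂ a)) + d * b₂ * p a ^ (1 + s) := by
    intro a
    rw [hμ₂ a, lintegral_withDensity_eq_lintegral_mul _ (hq a) (hfm a),
      ← lintegral_const_mul _ ((hq a).mul (hfm a))]
    calc ∫⁻ b, p a * (q a * f a) b ∂(ν₂ a)
        ≤ ∫⁻ b, (e * f a b + d * p a ^ (1 + s) * q a b ^ (1 + s)) ∂(ν₂ a) := by
          refine lintegral_mono fun b => ?_
          rw [Pi.mul_apply, ← mul_assoc, mul_assoc d, ← ENNReal.mul_rpow_of_nonneg _ _ hs']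
          exact mul_le_exp_mul_add (hf a b) hs ε
      _ = e * (∫⁻ b, f a b ∂(ν₂ a)) + d * p a ^ (1 + s) * ∫⁻ b, q a b ^ (1 + s) ∂(ν₂ a) := by
          rw [lintegral_add_left ((hfm a).const_mul e), lintegral_const_mul _ (hfm a),
            lintegral_const_mul _ ((hq a).pow_const _)]
      _ ≤ e * (∫⁻ b, f a b ∂(ν₂ a)) + d * p a ^ (1 + s) * b₂ := by gcongr; exact hqb a
      _ = _ := by ring
  rw [lintegral_withDensity_eq_lintegral_mul _ hp hμ]
  calc ∫⁻ a, (p * fun a => ∫⁻ b, f a b ∂(μ₂ a)) a ∂ν₁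
      ≤ ∫⁻ a, (e * (∫⁻ b, f a b ∂(ν₂ a)) + d * b₂ * p a ^ (1 + s)) ∂ν₁ :=
        lintegral_mono fun a => inner a
    _ = e * (∫⁻ a, ∫⁻ b, f a b ∂(ν₂ a) ∂ν₁) + d * b₂ * ∫⁻ a, p a ^ (1 + s) ∂ν₁ := by
        rw [lintegral_add_right _ ((hp.pow_const _).const_mul _),
          lintegral_const_mul' _ _ ENNReal.ofReal_ne_top, lintegral_const_mul _ (hp.pow_const _)]
    _ ≤ e * (∫⁻ a, ∫⁻ b, f a b ∂(ν₂ a) ∂ν₁) + d * b₂ * ENNReal.ofReal (Real.exp c₁) := by gcongr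
    _ = _ := by
        rw [← ENNReal.ofReal_mul (Real.exp_pos _).le, ← ENNReal.ofReal_mul (by positivity),
          ← Real.exp_add, ← Real.exp_add]
        congr 3
        ring

end Renyi

/-! ### Measurable dependence of discrete laws on a parameter. -/

section MeasurablePMF

/-- The function obtained by choosing, at each point, one of countably many measurable functions is
measurable if the choice is. -/
lemma measurable_of_countable_choice {α β κ : Type*} [MeasurableSpace α] [MeasurableSpace β]
    [Countable κ] {c : α → κ} (hc : ∀ k, MeasurableSet (c ⁻¹' {k})) {F : κ → α → β}
    (hF : ∀ k, Measurable (F k)) : Measurable fun a => F (c a) a := by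
  intro t ht
  have : (fun a => F (c a) a) ⁻¹' t = ⋃ k, c ⁻¹' {k} ∩ F k ⁻¹' t := by
    ext a
    simp
  rw [this]
  exact MeasurableSet.iUnion fun k => (hc k).inter (hF k ht)

variable {α β γ κ : Type*} [MeasurableSpace α]

/-- The probabilities depend measurably on the parameter. -/
def MeasurablePMF (f : α → PMF β) : Prop := ∀ b, Measurable fun a => f a b

lemma MeasurablePMF.const (p : PMF β) : MeasurablePMF fun _ : α => p := fun _ => measurable_const

lemma MeasurablePMF.bind [Countable β] {f : α → PMF β} {g : α → β → PMF γ}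
    (hf : MeasurablePMF f) (hg : ∀ b, MeasurablePMF fun a => g a b) :
    MeasurablePMF fun a => (f a).bind (g a) := by
  intro c
  simp only [PMF.bind_apply]
  exact Measurable.tsum fun b => (hf b).mul (hg b c)

lemma MeasurablePMF.map [Countable β] {f : α → PMF β} (hf : MeasurablePMF f) (g : β → γ) :
    MeasurablePMF fun a => (f a).map g :=
  hf.bind fun b => MeasurablePMF.const (PMF.pure (g b))

lemma MeasurablePMF.of_countable_choice [Countable κ] {c : α → κ}
    (hc : ∀ k, MeasurableSet (c ⁻¹' {k})) {F : κ → α → PMF β} (hF : ∀ k, MeasurablePMF (F k)) :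
    MeasurablePMF fun a => F (c a) a := fun b =>
  measurable_of_countable_choice hc (F := fun k a => F k a b) fun k => hF k b

lemma MeasurablePMF.measurable_toMeasure [MeasurableSpace β] [Countable β] {f : α → PMF β}
    (hf : MeasurablePMF f) : Measurable fun a => (f a).toMeasure := by
  refine Measure.measurable_of_measurable_coe _ fun t ht => ?_
  simp_rw [PMF.toMeasure_apply _ ht]
  refine Measurable.tsum fun b => ?_
  by_cases hb : b ∈ t
  · simpa [hb] using hf b
  · simp [hb]

end MeasurablePMF

/-! ### Measurability of the synthesis step. -/

section Generate

variable {α : Type*} [MeasurableSpace α]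

lemma measurablePMF_sampleWithoutReplacement {T : Type*} [Fintype T] [DecidableEq T] (k : ℕ)
    {p : α → T → ℝ≥0} (hp : ∀ t, Measurable fun a => p a t) :
    MeasurablePMF fun a => sampleWithoutReplacement k (p a) := by
  induction k generalizing p with
  | zero => exact MeasurablePMF.const _
  | succ k ih =>
    intro b
    have hsum : Measurable fun a => ∑' t, (p a t : ℝ≥0∞) :=
      Measurable.tsum fun t => (hp t).coe_nnreal_ennreal
    have hnext : ∀ t, MeasurablePMF fun a =>
        (sampleWithoutReplacement k (Function.update (p a) t 0)).map (insert t) := by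
      refine fun t => (ih fun t' => ?_).map _
      by_cases h : t' = t
      · subst h
        simp
      · simpa [h] using hp t'
    -- The case split becomes a sum of two indicators. Where the total weight vanishes its inverse
    -- is `∞`, but there the first indicator is zero.
    have key : ∀ a, sampleWithoutReplacement (k + 1) (p a) b =
        {a | ∑' t, (p a t : ℝ≥0∞) ≠ 0}.indicator (fun a => ∑' t, p a t * (∑' t, (p a t : ℝ≥0∞))⁻¹ *
          (sampleWithoutReplacement k (Function.update (p a) t 0)).map (insert t) b) a +
        {a | ∑' t, (p a t : ℝ≥0∞) = 0}.indicator (fun _ => PMF.pure (∅ : Finset T) b) a := by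
      intro a
      rw [sampleWithoutReplacement]
      split_ifs with h
      · rw [Set.indicator_of_mem (by exact h), Set.indicator_of_notMem (by exact h), add_zero,
          PMF.bind_apply]
        rfl
      · rw [Set.indicator_of_notMem (by exact h),
          Set.indicator_of_mem (by exact not_not.1 h), zero_add]
    simp_rw [key]
    have hset : MeasurableSet {a | ∑' t, (p a t : ℝ≥0∞) = 0} := hsum (measurableSet_singleton 0)
    exact ((Measurable.tsum fun t => ((hp t).coe_nnreal_ennreal.mul hsum.inv).mul
      (hnext t b)).indicator hset.compl).add (measurable_const.indicator hset)

lemma measurablePMF_syntheticColumn {T : Type*} [Fintype T] [DecidableEq T] {μ : α → T → ℝ}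
    (hμ : ∀ t, Measurable fun a => μ a t) (n : ℕ) :
    MeasurablePMF fun a => syntheticColumn (μ a) n := by
  have hfloor : ∀ t, Measurable fun a => ⌊μ a t⌋₊ := fun t => Nat.measurable_floor.comp (hμ t)
  -- The floors are frozen where they determine the number of draws and the multiset. They stay
  -- variable in the sampling weights, where measurability is enough.
  refine MeasurablePMF.of_countable_choice (c := fun a t => ⌊μ a t⌋₊)
    (F := fun k a => (sampleWithoutReplacement (n - ∑ t, k t)
      fun t => Real.toNNReal (μ a t - ⌊μ a t⌋₊)).bind
        fun extra => shuffle ((∑ t, Multiset.replicate (k t) t) + extra.val).toList)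
    (fun k => (measurable_pi_iff.2 hfloor) (measurableSet_singleton k)) fun k => ?_
  refine MeasurablePMF.bind (measurablePMF_sampleWithoutReplacement _ fun t => ?_)
    fun extra => MeasurablePMF.const _
  exact ((hμ t).sub (measurable_from_top.comp (hfloor t))).real_toNNReal

variable {ι : Type*} [Fintype ι] [DecidableEq ι] {Z : ι → Type*} [∀ i, Fintype (Z i)]

lemma measurable_modelProb {𝒞 : Finset (Finset ι)} {θ : α → Potential Z 𝒞} (hθ : Measurable θ)
    (x : Rec Z) : Measurable fun a => modelProb (θ a) x := by
  unfold modelProb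
  fun_prop

variable [∀ i, DecidableEq (Z i)]

lemma measurable_conditionalProb {P : α → Rec Z → ℝ} (hP : ∀ x, Measurable fun a => P a x) (i : ι)
    (B : Finset ι) (c : Cell Z B) (t : Z i) :
    Measurable fun a => conditionalProb (P a) i B c t := by
  unfold conditionalProb
  refine Measurable.div (Finset.measurable_fun_sum _ fun x _ => ?_)
    (Finset.measurable_fun_sum _ fun x _ => ?_)
  · split_ifs
    · exact hP x
    · exact measurable_const
  · split_ifs
    · exact hP x
    · exact measurable_const

lemma measurablePMF_fillColumn {P : α → Rec Z → ℝ} (hP : ∀ x, Measurable fun a => P a x) (i : ι)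
    (B : Finset ι) {n : ℕ} (cs : List (Cell Z B)) (r : Fin n → Rec Z) :
    MeasurablePMF fun a => fillColumn (P a) i B cs r := by
  induction cs generalizing r with
  | nil => exact MeasurablePMF.const _
  | cons c cs ih =>
    exact MeasurablePMF.bind (measurablePMF_syntheticColumn
      (fun t => (measurable_conditionalProb hP i B c t).const_mul _) _) fun col => ih _

lemma measurablePMF_fillColumns {P : α → Rec Z → ℝ} (hP : ∀ x, Measurable fun a => P a x)
    (𝒞 : Finset (Finset ι)) {n : ℕ} (is : List ι) (done : Finset ι) (r : Fin n → Rec Z) :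
    MeasurablePMF fun a => fillColumns (P a) 𝒞 is done r := by
  induction is generalizing done r with
  | nil => exact MeasurablePMF.const _
  | cons i is ih =>
    exact MeasurablePMF.bind (measurablePMF_fillColumn hP i _ _ r) fun r' => ih _ r'

/-- The row index type `Fin n` varies with the parameter, so the argument runs over the countably
many values of `n` separately. -/
lemma measurablePMF_generate {𝒞 : Finset (Finset ι)} {θ : α → Potential Z 𝒞} (hθ : Measurable θ)
    {n : α → ℕ} (hn : Measurable n) (order : List ι) (init : Rec Z) :
    MeasurablePMF fun a => generate (θ a) (n a) order init :=
  MeasurablePMF.of_countable_choice (F := fun n a => generate (θ a) n order init)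
    (fun k => hn (measurableSet_singleton k))
    fun _ => (measurablePMF_fillColumns (measurable_modelProb hθ) _ _ _ _).map _

variable {A : Type*} [Fintype A] [DecidableEq A] (S : Schema A)

instance : Countable (SynthData A) := inferInstanceAs (Countable (List (A → ℕ)))

lemma measurable_synthesize {sel : Kept S → Finset (Finset (TAttr A))} (pgm : PrivatePGM S sel)
    (order : Kept S → List (TAttr A)) (K : Kept S) :
    Measurable fun p : Log (TVal S) (oneWay (TAttr A)) × Log (CVal S K) (sel K) =>
      (synthesize S pgm order K p.1 p.2).toMeasure :=
  MeasurablePMF.measurable_toMeasure <| MeasurablePMF.bind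
    (measurablePMF_generate (pgm.measurable_potential K) (pgm.measurable_total K) _ _)
    fun _ => MeasurablePMF.const _

end Generate

/-! ### Privacy of one call of Measure. -/

section Measure

lemma Neighbor.map {R R' : Type*} {D D' : List R} (h : Neighbor D D') (f : R → R') :
    Neighbor (D.map f) (D'.map f) := by
  obtain ⟨l₁, l₂, x, h⟩ := h
  refine ⟨l₁.map f, l₂.map f, f x, ?_⟩
  rcases h with ⟨rfl, rfl⟩ | ⟨rfl, rfl⟩ <;> simp

lemma measurableSet_keptValues {ι : Type*} [DecidableEq ι] [Fintype ι] {X : ι → Type*}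
    [∀ i, Fintype (X i)] (K : (i : ι) → Finset (X i)) :
    MeasurableSet ((keptValues : Log X (oneWay ι) → _) ⁻¹' {K}) := by
  have : (keptValues : Log X (oneWay ι) → _) ⁻¹' {K} = ⋂ (i : ι) (a : X i), {log |
      3 * (oneWayEntry log i).2.2 ≤ (oneWayEntry log i).2.1 (singleCell i a) ↔ a ∈ K i} := by
    ext log
    simp only [Set.mem_preimage, Set.mem_singleton_iff, Set.mem_iInter, Set.mem_ofPred_eq,
      funext_iff, Finset.ext_iff, keptValues, Finset.mem_filter, Finset.mem_univ, true_and]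
  rw [this]
  refine MeasurableSet.iInter fun i => MeasurableSet.iInter fun a => ?_
  refine MeasurableSet.iff (measurableSet_le ?_ ?_) (MeasurableSet.const _)
  · unfold oneWayEntry
    fun_prop
  · unfold oneWayEntry
    fun_prop

/-- Equality can fail: if `𝒞` is empty or all weights vanish, division by zero makes the sum 0. -/
lemma sum_sq_normalizedWeight_le {ι : Type*} (𝒞 : Finset (Finset ι)) (w : Finset ι → ℝ) :
    ∑ C : 𝒞, normalizedWeight 𝒞 w C.1 ^ 2 ≤ 1 := by
  rw [Finset.sum_coe_sort 𝒞 fun C => normalizedWeight 𝒞 w C ^ 2]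
  simp only [normalizedWeight, div_pow]
  rw [← Finset.sum_div, Real.sq_sqrt (Finset.sum_nonneg fun _ _ => sq_nonneg _)]
  exact div_self_le_one _

variable {ι : Type*} {X : ι → Type*} [∀ i, DecidableEq (X i)]

lemma marginal_append_cons (C : Finset ι) (l₁ l₂ : Dataset X) (x : Rec X) (t : Cell X C) :
    marginal C (l₁ ++ x :: l₂) t =
      marginal C (l₁ ++ l₂) t + if C.restrict x = t then 1 else 0 := by
  simp only [marginal, List.countP_append, List.countP_cons, decide_eq_true_eq]
  split_ifs <;> push_cast <;> ring

variable [DecidableEq ι] [∀ i, Fintype (X i)]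

/-- Adding a record changes one entry of a marginal table, by one. -/
lemma Neighbor.sum_sq_marginal_sub {D D' : Dataset X} (h : Neighbor D D') (C : Finset ι) :
    ∑ t, (marginal C D t - marginal C D' t) ^ 2 = 1 := by
  obtain ⟨l₁, l₂, x, h⟩ := h
  have key : ∀ t, (marginal C D t - marginal C D' t) ^ 2 = if C.restrict x = t then 1 else 0 := by
    intro t
    rcases h with ⟨rfl, rfl⟩ | ⟨rfl, rfl⟩ <;> rw [marginal_append_cons] <;> split_ifs <;> ring
  simp [key]

/-- Moving the weighted tables into the means exhibits the log as a product of Gaussians followed by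
an embedding that does not depend on `D`. -/
lemma measureMarginals_eq (σ : ℝ) (𝒞 : Finset (Finset ι)) (w : Finset ι → ℝ) (D : Dataset X) :
    measureMarginals σ 𝒞 w D =
      (Measure.pi fun C : 𝒞 => Measure.pi fun t : Cell X C.1 =>
        gaussianReal (normalizedWeight 𝒞 w C.1 * marginal C.1 D t) (Real.toNNReal (σ ^ 2))).map
      fun y C => (normalizedWeight 𝒞 w C.1, y C, σ) := by
  have inner : ∀ C : 𝒞, (Measure.pi fun _ : Cell X C.1 => gaussianReal 0 (Real.toNNReal (σ ^ 2))).map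
        (fun z t => normalizedWeight 𝒞 w C.1 * marginal C.1 D t + z t) =
      Measure.pi (fun t : Cell X C.1 =>
        gaussianReal (normalizedWeight 𝒞 w C.1 * marginal C.1 D t) (Real.toNNReal (σ ^ 2))) := by
    intro C
    have (t : Cell X C.1) : IsProbabilityMeasure ((gaussianReal 0 (Real.toNNReal (σ ^ 2))).map
        fun z => normalizedWeight 𝒞 w C.1 * marginal C.1 D t + z) :=
      Measure.isProbabilityMeasure_map (by fun_prop)
    rw [Measure.pi_map_pi (f := fun t z => normalizedWeight 𝒞 w C.1 * marginal C.1 D t + z)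
      fun t => by fun_prop]
    simp_rw [gaussianReal_map_const_add, zero_add]
  have hm : ∀ C : 𝒞, Measurable fun (z : Cell X C.1 → ℝ) t =>
      normalizedWeight 𝒞 w C.1 * marginal C.1 D t + z t := fun C => by fun_prop
  have (C : 𝒞) : IsProbabilityMeasure
      ((Measure.pi fun _ : Cell X C.1 => gaussianReal 0 (Real.toNNReal (σ ^ 2))).map
        fun z t => normalizedWeight 𝒞 w C.1 * marginal C.1 D t + z t) :=
    Measure.isProbabilityMeasure_map (hm C).aemeasurable
  simp_rw [← inner]
  rw [← Measure.pi_map_pi fun C => (hm C).aemeasurable, Measure.map_map (by fun_prop) (by fun_prop)]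
  rfl

instance (σ : ℝ) (𝒞 : Finset (Finset ι)) (w : Finset ι → ℝ) (D : Dataset X) :
    IsProbabilityMeasure (measureMarginals σ 𝒞 w D) :=
  measureMarginals_eq σ 𝒞 w D ▸ Measure.isProbabilityMeasure_map (Measurable.aemeasurable (by fun_prop))

/-- The privacy guarantee of one call of "Measure Marginals". -/
lemma renyiBound_measureMarginals {σ s : ℝ} (hσ : 0 < σ) (hs : 0 ≤ s) (𝒞 : Finset (Finset ι))
    (w : Finset ι → ℝ) {D D' : Dataset X} (h : Neighbor D D') :
    RenyiBound s (s * (1 + s) / 2 / σ ^ 2) (measureMarginals σ 𝒞 w D)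
      (measureMarginals σ 𝒞 w D') := by
  have hv : Real.toNNReal (σ ^ 2) ≠ 0 := by positivity
  have hv' : (Real.toNNReal (σ ^ 2) : ℝ) = σ ^ 2 := Real.coe_toNNReal _ (sq_nonneg σ)
  rw [measureMarginals_eq, measureMarginals_eq]
  -- The other log entries are constants, so reading off the noisy tables is a left inverse.
  refine RenyiBound.map (l := fun log C => (log C).2.1) (RenyiBound.mono (RenyiBound.pi hs fun C =>
    RenyiBound.pi hs fun t => renyiBound_gaussianReal s _ _ hv) ?_) (by fun_prop) (by fun_prop)
    fun _ => rfl
  -- Each table contributes `w_C²` times its squared change, which is 1; the total is bounded by the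
  -- normalization.
  simp_rw [hv', ← mul_sub, mul_pow, ← Finset.sum_div, ← Finset.mul_sum, h.sum_sq_marginal_sub,
    mul_one]
  gcongr
  exact mul_le_of_le_one_right (by positivity) (sum_sq_normalizedWeight_le 𝒞 w)

end Measure

/-! ### Adaptive composition, calibration of the noise, and the mechanism. -/

section Mechanism

lemma measurable_bind_right {α β γ : Type*} [MeasurableSpace α] [MeasurableSpace β]
    [MeasurableSpace γ] (μ : Measure β) [SFinite μ] {κ : α → β → Measure γ}
    (hκ : Measurable fun p : α × β => κ p.1 p.2) : Measurable fun a => μ.bind (κ a) := by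
  refine Measure.measurable_of_measurable_coe _ fun t ht => ?_
  have : (fun a => μ.bind (κ a) t) = fun a => ∫⁻ b, κ a b t ∂μ := funext fun a =>
    Measure.bind_apply ht (hκ.comp measurable_prodMk_left).aemeasurable
  rw [this]
  exact ((Measure.measurable_coe ht).comp hκ).lintegral_prod_right'

lemma isProbabilityMeasure_bind {α β : Type*} [MeasurableSpace α] [MeasurableSpace β]
    (μ : Measure α) [IsProbabilityMeasure μ] {κ : α → Measure β} (hκ : Measurable κ)
    (h : ∀ a, IsProbabilityMeasure (κ a)) : IsProbabilityMeasure (μ.bind κ) :=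
  ⟨by simp [Measure.bind_apply MeasurableSet.univ hκ.aemeasurable]⟩

section Adaptive

variable {α κ γ : Type*} {β : κ → Type*} [MeasurableSpace α] [MeasurableSpace γ]
  [∀ k, MeasurableSpace (β k)] [Countable κ] {c : α → κ} (hc : ∀ k, MeasurableSet (c ⁻¹' {k}))
  {F : (k : κ) → α → β k → Measure γ} (hF : ∀ k, Measurable fun p : α × β k => F k p.1 p.2)

include hc hF

/-- The type of the second log depends on `c a`, so joint measurability is available only for a
fixed value `k`; countability of `κ` glues the pieces. -/
lemma measurable_adaptive (μ₂ : (k : κ) → Measure (β k)) [∀ k, SFinite (μ₂ k)] :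
    Measurable fun a => (μ₂ (c a)).bind (F (c a) a) :=
  measurable_of_countable_choice hc (F := fun k a => (μ₂ k).bind (F k a))
    fun k => measurable_bind_right (μ₂ k) (hF k)

/-- A mechanism that runs `μ₁` first, and then, on the outcome `a`, runs `μ₂ (c a)` and
post-processes the two outcomes. -/
lemma isProbabilityMeasure_adaptive [∀ k a b, IsProbabilityMeasure (F k a b)] (μ₁ : Measure α)
    (μ₂ : (k : κ) → Measure (β k)) [IsProbabilityMeasure μ₁] [∀ k, IsProbabilityMeasure (μ₂ k)] :
    IsProbabilityMeasure (μ₁.bind fun a => (μ₂ (c a)).bind (F (c a) a)) :=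
  isProbabilityMeasure_bind _ (measurable_adaptive hc hF μ₂) fun a =>
    isProbabilityMeasure_bind _ ((hF (c a)).comp measurable_prodMk_left) fun _ => inferInstance

lemma adaptive_apply (μ₁ : Measure α) (μ₂ : (k : κ) → Measure (β k)) [∀ k, SFinite (μ₂ k)]
    {E : Set γ} (hE : MeasurableSet E) :
    (μ₁.bind fun a => (μ₂ (c a)).bind (F (c a) a)) E =
      ∫⁻ a, ∫⁻ b, F (c a) a b E ∂(μ₂ (c a)) ∂μ₁ := by
  rw [Measure.bind_apply hE (measurable_adaptive hc hF μ₂).aemeasurable]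
  exact lintegral_congr fun a => Measure.bind_apply hE
    ((hF (c a)).comp measurable_prodMk_left).aemeasurable

/-- The randomized test is `F (c a) a b E`, the conditional probability of the event. It is the same
function for both inputs, which is why post-processing costs nothing. -/
lemma RenyiBound.adaptive_le [∀ k a b, IsProbabilityMeasure (F k a b)] {s c₁ c₂ : ℝ} (hs : 0 ≤ s)
    {μ₁ ν₁ : Measure α} {μ₂ ν₂ : (k : κ) → Measure (β k)} [∀ k, SFinite (μ₂ k)]
    [∀ k, SFinite (ν₂ k)] (h₁ : RenyiBound s c₁ μ₁ ν₁)
    (h₂ : ∀ k, RenyiBound s c₂ (μ₂ k) (ν₂ k)) {E : Set γ} (hE : MeasurableSet E) (ε : ℝ) :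
    (μ₁.bind fun a => (μ₂ (c a)).bind (F (c a) a)) E ≤
      ENNReal.ofReal (Real.exp ε) * (ν₁.bind fun a => (ν₂ (c a)).bind (F (c a) a)) E +
        ENNReal.ofReal (Real.exp (-(ε * s) + (c₁ + c₂))) := by
  have hFr : ∀ k a, Measurable (F k a) := fun k a => (hF k).comp measurable_prodMk_left
  rw [adaptive_apply hc hF μ₁ μ₂ hE, adaptive_apply hc hF ν₁ ν₂ hE]
  refine RenyiBound.lintegral_lintegral_le hs h₁ (fun a => h₂ (c a)) (fun _ _ => prob_le_one)
    (fun a => (Measure.measurable_coe hE).comp (hFr (c a) a)) ?_ ε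
  have := (Measure.measurable_coe hE).comp (measurable_adaptive hc hF μ₂)
  simp_rw [← fun a => Measure.bind_apply hE (hFr (c a) a).aemeasurable (m := μ₂ (c a))]
  exact this

end Adaptive

lemma calibrate_pos {ε δ : ℝ} (hε : 0 < ε) (hδ : 0 < δ) (hδ' : δ ≤ 1) : 0 < calibrate ε δ := by
  have : 0 ≤ Real.log (1 / δ) := Real.log_nonneg (by rwa [le_div_iff₀ hδ, one_mul])
  unfold calibrate
  positivity

/-- The noise scale converts the Rényi bound of two adaptive Gaussian mechanisms of order
`1 + √(log (1 / δ)) σ` into `(ε, δ)`-differential privacy. -/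
lemma exp_calibrate {ε δ : ℝ} (hε : 0 < ε) (hδ : 0 < δ) (hδ' : δ ≤ 1) {s : ℝ}
    (hs : s = Real.sqrt (Real.log (1 / δ)) * calibrate ε δ) :
    Real.exp (-(ε * s) + (s * (1 + s) / 2 / calibrate ε δ ^ 2 +
      s * (1 + s) / 2 / calibrate ε δ ^ 2)) = δ := by
  have hL : 0 ≤ Real.log (1 / δ) := Real.log_nonneg (by rwa [le_div_iff₀ hδ, one_mul])
  have hσ := calibrate_pos hε hδ hδ'
  set σ := calibrate ε δ
  set a := Real.sqrt (Real.log (1 / δ))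
  set b := Real.sqrt (Real.log (1 / δ) + ε)
  have ha : a ^ 2 = Real.log (1 / δ) := Real.sq_sqrt hL
  have hb : b ^ 2 = Real.log (1 / δ) + ε := Real.sq_sqrt (by positivity)
  have hσε : σ * ε = a + b := div_mul_cancel₀ _ hε.ne'
  -- From `(a + b)(b - a) = ε`. Thus `1 / σ = b - a`, which turns the divisions by `σ²` into
  -- polynomials.
  have hσb : σ * (b - a) = 1 := by
    refine mul_right_cancel₀ hε.ne' ?_
    linear_combination (b - a) * hσε + hb - ha
  -- Since `ε σ² = 2 a σ + 1`, the choice `s = a σ` minimizes `-ε s + s(1 + s)/σ²`, and the minimum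
  -- is `-a² = log δ`.
  have key : -(ε * s) + (s * (1 + s) / 2 / σ ^ 2 + s * (1 + s) / 2 / σ ^ 2) = -a ^ 2 := by
    have hinv : ∀ x, x / σ ^ 2 = x * (b - a) ^ 2 := fun x => by
      rw [div_eq_iff (by positivity)]
      linear_combination (-x * (σ * (b - a) + 1)) * hσb
    rw [hs, hinv]
    linear_combination (-a) * hσε + (a * (b - a) + a ^ 2 * (σ * (b - a) + 1)) * hσb
  rw [key, ha, one_div, Real.log_inv, neg_neg, Real.exp_log hδ]

variable {A : Type*} [Fintype A] [DecidableEq A] (S : Schema A)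
  {sel : Kept S → Finset (Finset (TAttr A))} (pgm : PrivatePGM S sel)
  (order : Kept S → List (TAttr A))

lemma isProbabilityMeasure_nistMST (ε δ : ℝ) (D : Dataset (Val S)) :
    IsProbabilityMeasure (nistMST S pgm order ε δ D) := by
  have := isProbabilityMeasure_adaptive measurableSet_keptValues
    (F := fun K log₁ log₂ => (synthesize S pgm order K log₁ log₂).toMeasure)
    (measurable_synthesize S pgm order)
    (measureMarginals (calibrate ε δ) (oneWay (TAttr A)) (oneWayWeight S)
      (D.map (transformRecord S)))
    (fun K => measureMarginals (calibrate ε δ) (sel K)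
      (selectionWeight ε (some S.sex) (some S.city) (some S.incwage)) (compressedData S K D))
  exact this

/-- Transformation and compression with a fixed `K` act record by record, so neighbours stay
neighbours. For a given `K` both inputs are measured on the same collection `sel K`, since selection
sees only `K` and public data. -/
lemma isDP_nistMST {ε δ : ℝ} (hε : 0 < ε) (hδ : 0 < δ) (hδ' : δ ≤ 1) :
    IsDP (nistMST S pgm order ε δ) ε δ := by
  intro D D' hD E hE
  have hσ := calibrate_pos hε hδ hδ'
  have hs : 0 ≤ Real.sqrt (Real.log (1 / δ)) * calibrate ε δ := by positivity
  have := RenyiBound.adaptive_le measurableSet_keptValues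
    (F := fun K log₁ log₂ => (synthesize S pgm order K log₁ log₂).toMeasure)
    (measurable_synthesize S pgm order) hs
    (renyiBound_measureMarginals hσ hs (oneWay (TAttr A)) (oneWayWeight S)
      (hD.map (transformRecord S)))
    (fun K => renyiBound_measureMarginals hσ hs (sel K)
      (selectionWeight ε (some S.sex) (some S.city) (some S.incwage))
      ((hD.map (transformRecord S)).map (compressRecord K))) hE ε
  rw [exp_calibrate hε hδ hδ' rfl] at this
  exact this

end Mechanism

end NISTMST

theorem mainTheorem1 {A : Type*} [Fintype A] [DecidableEq A] (S : NISTMST.Schema A)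
    (provisional : NISTMST.Dataset (NISTMST.Val S))
    (sel : NISTMST.Kept S → Finset (Finset (NISTMST.TAttr A)))
    (hsel : NISTMST.IsSelection S provisional sel)
    (pgm : NISTMST.PrivatePGM S sel)
    (order : NISTMST.Kept S → List (NISTMST.TAttr A))
    (horder : ∀ K, (order K).Nodup ∧ ∀ i, i ∈ order K)
    (ε δ : ℝ) (hε : 0 < ε) (hδ : 0 < δ) (hδ' : δ ≤ 1) :
    (∀ D, IsProbabilityMeasure (NISTMST.nistMST S pgm order ε δ D)) ∧
      NISTMST.IsDP (NISTMST.nistMST S pgm order ε δ) ε δ :=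
  ⟨NISTMST.isProbabilityMeasure_nistMST S pgm order ε δ,
    NISTMST.isDP_nistMST S pgm order hε hδ hδ'⟩
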